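/- **Corollary 7.4 ($n$-Gorenstein skew group rings).** Let $R$ be an associative ring with identity, let $G$ be a finite group acting on $R$ by ring automorphisms, let $H$ be a subgroup of $G$, and let $n\ge 0$ be an integer. Let $RG$ be the skew group ring: the free left $R$-module with basis $G$, with multiplication determined by $(ag)(bh)=a\,g(b)\,gh$ for $a,b\in R$, $g,h\in G$. Let $RH\subseteq RG$ be the skew group ring of the restricted action of $H$. A ring $A$ is called *$n$-Gorenstein* if it is left and right Noetherian and has injective dimension at most $n$ both as a left and as a right module over itself. A ring $A$ is called *separable* over a subring $S$ if the multiplication map $A\otimes_S A\to A$, $a\otimes b\mapsto ab$, splits as a homomorphism of $A$-$A$-bimodules. Then: 1. If $RG$ is $n$-Gorenstein, then $RH$ is $n$-Gorenstein. 2. If $RG$ is separable over $RH$, then $RG$ is $n$-Gorenstein if and only if $RH$ is $n$-Gorenstein. -/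

import Mathlib

open scoped TensorProduct

noncomputable section

/-! ### Separable ring extensions, with no commutativity assumed -/

section Separable

variable {S R : Type*} [Ring S] [Ring R] (f : S →+* R)

/-- The subgroup of `R ⊗[ℤ] R` spanned by the elements `(a s) ⊗ b - a ⊗ (s b)`
with `a`, `b` in `R` and `s` in `S`. -/
def balancedRelations : Submodule ℤ (R ⊗[ℤ] R) :=
  Submodule.span ℤ {x | ∃ (a : R) (s : S) (b : R),
    x = (a * f s) ⊗ₜ[ℤ] b - a ⊗ₜ[ℤ] (f s * b)}

/-- The tensor product `R ⊗_S R` of the right `S`-module `R` and the left `S`-module `R`,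
for a homomorphism `f : S →+* R` of (possibly noncommutative) rings. -/
abbrev RelTensor : Type _ := (R ⊗[ℤ] R) ⧸ balancedRelations f

/-- The element `a ⊗ b` of `R ⊗_S R`. -/
def relTmul (a b : R) : RelTensor f := (balancedRelations f).mkQ (a ⊗ₜ[ℤ] b)

theorem relTmul_balanced (a : R) (s : S) (b : R) :
    relTmul f (a * f s) b = relTmul f a (f s * b) :=
  (Submodule.Quotient.eq _).2 (Submodule.subset_span ⟨a, s, b, rfl⟩)

/-- The left action of `R` on `R ⊗_S R`: `r (a ⊗ b) = (r a) ⊗ b`. -/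
def relTensorLeft (r : R) : RelTensor f →ₗ[ℤ] RelTensor f :=
  Submodule.mapQ _ _ (TensorProduct.map (LinearMap.mulLeft ℤ r) LinearMap.id) <| by
    rw [balancedRelations, Submodule.span_le]
    rintro _ ⟨a, s, b, rfl⟩
    refine Submodule.subset_span ⟨r * a, s, b, ?_⟩
    refine (map_sub (TensorProduct.map (LinearMap.mulLeft ℤ r) LinearMap.id) _ _).trans ?_
    simp only [TensorProduct.map_tmul, LinearMap.mulLeft_apply, LinearMap.id_apply, mul_assoc]

/-- The right action of `R` on `R ⊗_S R`: `(a ⊗ b) r = a ⊗ (b r)`. -/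
def relTensorRight (r : R) : RelTensor f →ₗ[ℤ] RelTensor f :=
  Submodule.mapQ _ _ (TensorProduct.map LinearMap.id (LinearMap.mulRight ℤ r)) <| by
    rw [balancedRelations, Submodule.span_le]
    rintro _ ⟨a, s, b, rfl⟩
    refine Submodule.subset_span ⟨a, s, b * r, ?_⟩
    refine (map_sub (TensorProduct.map LinearMap.id (LinearMap.mulRight ℤ r)) _ _).trans ?_
    simp only [TensorProduct.map_tmul, LinearMap.mulRight_apply, LinearMap.id_apply, mul_assoc]

/-- The multiplication map `R ⊗_S R → R`, `a ⊗ b ↦ a b`. -/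
def relTensorMul : RelTensor f →ₗ[ℤ] R :=
  Submodule.liftQ _ (LinearMap.mul' ℤ R) <| by
    rw [balancedRelations, Submodule.span_le]
    rintro _ ⟨a, s, b, rfl⟩
    refine LinearMap.mem_ker.2 ((map_sub (LinearMap.mul' ℤ R) _ _).trans ?_)
    rw [LinearMap.mul'_apply, LinearMap.mul'_apply, mul_assoc, sub_self]

@[simp] theorem relTensorLeft_tmul (r a b : R) :
    relTensorLeft f r (relTmul f a b) = relTmul f (r * a) b := rfl

@[simp] theorem relTensorRight_tmul (r a b : R) :
    relTensorRight f r (relTmul f a b) = relTmul f a (b * r) := rfl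

@[simp] theorem relTensorMul_tmul (a b : R) :
    relTensorMul f (relTmul f a b) = a * b := rfl

/-- `R` is a separable extension of `S` (along `f`): the multiplication map `R ⊗_S R → R`
splits as a homomorphism of `R`-`R`-bimodules. -/
def IsSeparableExtension : Prop :=
  ∃ σ : R →+ RelTensor f,
    (∀ r x, σ (r * x) = relTensorLeft f r (σ x)) ∧
    (∀ r x, σ (x * r) = relTensorRight f r (σ x)) ∧
    ∀ x, relTensorMul f (σ x) = x

theorem relTensor_induction {p : RelTensor f → Prop} (z : RelTensor f) (h0 : p 0)
    (ht : ∀ a b, p (relTmul f a b)) (ha : ∀ x y, p x → p y → p (x + y)) : p z := by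
  obtain ⟨z, rfl⟩ := (balancedRelations f).mkQ_surjective z
  induction z with
  | zero => simpa using h0
  | tmul a b => exact ht a b
  | add x y hx hy => rw [map_add]; exact ha _ _ hx hy

/-- Separability through a separability element. -/
theorem isSeparableExtension_iff :
    IsSeparableExtension f ↔ ∃ e : RelTensor f,
      (∀ r, relTensorLeft f r e = relTensorRight f r e) ∧ relTensorMul f e = 1 := by
  constructor
  · rintro ⟨σ, hl, hr, hm⟩
    exact ⟨σ 1, fun r => by rw [← hl, ← hr, mul_one, one_mul], hm 1⟩
  · rintro ⟨e, he, h1⟩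
    have hadd : ∀ (x y : R) (z : RelTensor f),
        relTensorLeft f (x + y) z = relTensorLeft f x z + relTensorLeft f y z := by
      intro x y z
      induction z using relTensor_induction with
      | h0 => simp
      | ht a b =>
        rw [relTensorLeft_tmul, relTensorLeft_tmul, relTensorLeft_tmul, add_mul, relTmul,
          TensorProduct.add_tmul, map_add]
        rfl
      | ha u v hu hv => rw [map_add, map_add, map_add, hu, hv]; abel
    have hmul : ∀ (x y : R) (z : RelTensor f),
        relTensorLeft f (x * y) z = relTensorLeft f x (relTensorLeft f y z) := by
      intro x y z
      induction z using relTensor_induction with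
      | h0 => simp
      | ht a b => simp [mul_assoc]
      | ha u v hu hv => simp only [map_add, hu, hv]
    have hcomm : ∀ (x y : R) (z : RelTensor f),
        relTensorLeft f x (relTensorRight f y z) = relTensorRight f y (relTensorLeft f x z) := by
      intro x y z
      induction z using relTensor_induction with
      | h0 => simp
      | ht a b => simp
      | ha u v hu hv => simp only [map_add, hu, hv]
    have hone : ∀ (x : R) (z : RelTensor f),
        relTensorMul f (relTensorLeft f x z) = x * relTensorMul f z := by
      intro x z
      induction z using relTensor_induction with
      | h0 => simp
      | ht a b => simp [mul_assoc]
      | ha u v hu hv => simp only [map_add, hu, hv, mul_add]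
    refine ⟨AddMonoidHom.mk' (fun x => relTensorLeft f x e) fun x y => hadd x y e,
      fun r x => hmul r x e, fun r x => ?_, fun x => ?_⟩
    · change relTensorLeft f (x * r) e = relTensorRight f r (relTensorLeft f x e)
      rw [hmul, he r, hcomm]
    · change relTensorMul f (relTensorLeft f x e) = x
      rw [hone, h1, mul_one]

end Separable

/-! ### Skew group rings -/

section SkewGroupRing

variable (R : Type*) {G : Type*} [Ring R] [Group G] [MulSemiringAction G R] (H : Subgroup G)

/-- The inclusion `RH → RG` of skew group rings, `∑ r_h h ↦ ∑ r_h h`, for a subgroup `H`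
of a group `G` acting on `R`. -/
def skewInclusion : SkewMonoidAlgebra R H →+* SkewMonoidAlgebra R G :=
  SkewMonoidAlgebra.mapDomainRingHom (f := H.subtype) fun _ _ => rfl

theorem skewInclusion_single (h : H) (r : R) :
    skewInclusion R H (SkewMonoidAlgebra.single h r) = SkewMonoidAlgebra.single (h : G) r :=
  SkewMonoidAlgebra.mapDomain_single

theorem skewInclusion_injective : Function.Injective (skewInclusion R H) := by
  intro x y h
  apply SkewMonoidAlgebra.coeff_injective
  apply Finsupp.mapDomain_injective H.subtype_injective
  have := congrArg SkewMonoidAlgebra.coeff h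
  exact (SkewMonoidAlgebra.coeff_mapDomain _ _).symm.trans
    (this.trans (SkewMonoidAlgebra.coeff_mapDomain _ _))

end SkewGroupRing

/-! ### Gorenstein rings -/

/-- A ring `A` is `n`-Gorenstein if it is left and right Noetherian and has injective
dimension at most `n` both as a left module and as a right module over itself
(right modules over `A` being left modules over `Aᵐᵒᵖ`). -/
structure IsNGorenstein (n : ℕ) (A : Type*) [Ring A] : Prop where
  left_noetherian : IsNoetherian A A
  right_noetherian : IsNoetherian Aᵐᵒᵖ A
  left_injectiveDimension : CategoryTheory.HasInjectiveDimensionLE (ModuleCat.of A A) n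
  right_injectiveDimension : CategoryTheory.HasInjectiveDimensionLE (ModuleCat.of Aᵐᵒᵖ A) n

end

/-! `RG` is a Frobenius extension of `RH`: the projection `E` of `RG` onto the coefficients at `H`
is an `RH`-bimodule map, with left coset representatives and their inverses as dual bases
(`skewFrobeniusSystem`), and `E` is the identity on `RH`.

For any Frobenius extension `S → T`, coextension `Hom_S(T, -)` is left adjoint to restriction as
well as right adjoint. Hence both functors are exact and preserve injectives, so neither raises
injective dimension. Coextension sends `S` to `T`, which bounds the dimension of `T` by that of `S`;
if `E` retracts `T` onto `S`, then `S` is a summand of the restriction of `T`, which gives the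
reverse bound. The Noetherian condition ascends because `T` is finite over `S`, and descends because
`E` recovers a left ideal of `S` from its extension to `T`. Right-handed statements follow from the
opposite Frobenius system. -/

noncomputable section

/-! ### Injective dimension and exact functors -/

section ExactFunctor

open CategoryTheory Limits

universe v₁ v₂ u₁ u₂

/-- An exact functor preserving injective objects does not increase injective dimensions. -/
theorem CategoryTheory.Functor.hasInjectiveDimensionLT_obj {C : Type u₁} {D : Type u₂}
    [Category.{v₁} C] [Category.{v₂} D] [Abelian C] [Abelian D] [EnoughInjectives C]
    (F : C ⥤ D) [F.PreservesZeroMorphisms] [PreservesFiniteLimits F] [PreservesFiniteColimits F]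
    [F.PreservesInjectiveObjects] (n : ℕ) (X : C) [hX : HasInjectiveDimensionLT X n] :
    HasInjectiveDimensionLT (F.obj X) n := by
  induction n generalizing X with
  | zero =>
    rw [hasInjectiveDimensionLT_zero_iff_isZero] at hX ⊢
    exact F.map_isZero hX
  | succ n ih =>
    -- Dimension `< 1` means injective, so it is covered by the hypothesis on `F`. From `< 2` on,
    -- the cokernel of an embedding into an injective has its bound lowered by one, and `F`
    -- preserves this exact sequence and its injective middle term.
    obtain _ | n := n
    · have : Injective X := injective_iff_hasInjectiveDimensionLT_one.2 hX
      have := F.injective_obj_of_injective this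
      infer_instance
    · have hS : (ShortComplex.mk _ _ (cokernel.condition (Injective.ι X))).ShortExact :=
        { exact := ShortComplex.exact_cokernel _ }
      have h₃ := (hS.hasInjectiveDimensionLT_X₃_iff n inferInstance).2 hX
      exact ((hS.map_of_exact F).hasInjectiveDimensionLT_X₃_iff n
        (F.injective_obj_of_injective (inferInstanceAs (Injective (Injective.under X))))).1
          (ih _ (hX := h₃))

end ExactFunctor

/-! ### Frobenius extensions -/

universe u

/-- A Frobenius system for a ring homomorphism `f : S →+* T`: an `S`-`S`-bimodule map
`E : T → S` together with finite dual bases `x` and `y`. -/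
structure FrobeniusSystem {S T : Type*} [Ring S] [Ring T] (f : S →+* T) where
  /-- The Frobenius homomorphism. -/
  E : T →+ S
  map_left : ∀ s t, E (f s * t) = s * E t
  map_right : ∀ t s, E (t * f s) = E t * s
  /-- The index type of the dual bases. -/
  ι : Type*
  [fintype : Fintype ι]
  /-- The basis of `T` as a right module. -/
  x : ι → T
  /-- The basis of `T` as a left module. -/
  y : ι → T
  sum_left : ∀ t, ∑ i, x i * f (E (y i * t)) = t
  sum_right : ∀ t, ∑ i, f (E (t * x i)) * y i = t

namespace FrobeniusSystem

attribute [instance] fintype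

/-! ### Opposite systems and the Noetherian condition. -/

section Ring

variable {S T : Type*} [Ring S] [Ring T] {f : S →+* T} (F : FrobeniusSystem f)

/-- The Frobenius system of the homomorphism of opposite rings. -/
def op : FrobeniusSystem f.op where
  E := AddMonoidHom.mulOp F.E
  map_left s t := congrArg MulOpposite.op (F.map_right t.unop s.unop)
  map_right t s := congrArg MulOpposite.op (F.map_left s.unop t.unop)
  ι := F.ι
  x i := .op (F.y i)
  y i := .op (F.x i)
  sum_left t := MulOpposite.unop_injective <| by
    simpa using F.sum_right t.unop
  sum_right t := MulOpposite.unop_injective <| by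
    simpa using F.sum_left t.unop

include F in
/-- A Frobenius extension of a left Noetherian ring is left Noetherian. -/
theorem isNoetherian (h : IsNoetherian S S) : IsNoetherian T T := by
  let _ : Module S T := Module.compHom T f
  have : IsScalarTower S T T := ⟨fun s t t' => mul_assoc (f s) t t'⟩
  have : Module.Finite S T := by
    refine ⟨Submodule.fg_def.2 ⟨Set.range F.y, Set.finite_range _, ?_⟩⟩
    refine eq_top_iff.2 fun t _ => ?_
    rw [← F.sum_right t]
    exact Submodule.sum_mem _ fun i _ => Submodule.smul_mem _ (F.E (t * F.x i))
      (Submodule.subset_span (by simp))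
  have : IsNoetherian S T := isNoetherian_of_isNoetherianRing_of_finite S T
  exact isNoetherian_of_tower S this

/-- If the Frobenius homomorphism of a Frobenius extension `T` of `S` restricts to the identity
of `S` and `T` is left Noetherian, then so is `S`. -/
theorem isNoetherian_of_retraction (hE : ∀ s, F.E (f s) = s) (h : IsNoetherian T T) :
    IsNoetherian S S := by
  -- `E` maps the left ideal generated by `f(I)` into `I`, since `E (a * f s) = E a * s`. The factor
  -- `a` carries the induction through left multiplication. Thus extension of left ideals is
  -- injective.
  have key (I : Ideal S) {s : S} (hs : f s ∈ I.map f) : s ∈ I := by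
    suffices ∀ t ∈ I.map f, ∀ a, F.E (a * t) ∈ I by simpa [hE] using this _ hs 1
    intro t ht
    induction ht using Submodule.span_induction with
    | mem t ht =>
      obtain ⟨s, hs, rfl⟩ := ht
      exact fun a => F.map_right a s ▸ I.mul_mem_left _ hs
    | zero => simp
    | add t t' _ _ ht ht' =>
      intro a
      rw [mul_add, map_add]
      exact I.add_mem (ht a) (ht' a)
    | smul b t _ ht =>
      intro a
      rw [smul_eq_mul, ← mul_assoc]
      exact ht _
  rw [isNoetherian_iff'] at h ⊢
  refine StrictMono.wellFoundedGT (f := Ideal.map f) (Monotone.strictMono_of_injective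
    (fun I J => Ideal.map_mono) fun I J hIJ => ?_)
  exact le_antisymm (fun s hs => key J (hIJ ▸ Ideal.mem_map_of_mem f hs))
    fun s hs => key I (hIJ ▸ Ideal.mem_map_of_mem f hs)

end Ring

/-! ### Restriction, coextension and injective dimension. -/

section ModuleCat

open CategoryTheory ModuleCat

variable {S T : Type u} [Ring S] [Ring T] {f : S →+* T} (F : FrobeniusSystem f)

/-- The unit of the adjunction between coextension and restriction of scalars. -/
def unit : 𝟭 (ModuleCat.{u} S) ⟶ coextendScalars.{u, u, u} f ⋙ restrictScalars f where
  app N := ofHom (Y := (restrictScalars f).obj ((coextendScalars f).obj N))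
    { toFun n := (CoextendScalars.equiv f N).symm
        { toFun (t : T) := F.E t • (n : N)
          map_add' (a b : T) := (congrArg (· • (n : N)) (F.E.map_add a b)).trans (add_smul _ _ _)
          map_smul' s (t : T) := (congrArg (· • (n : N)) (F.map_left s t)).trans (mul_smul _ _ _) }
      map_add' a b := CoextendScalars.ext <| LinearMap.ext fun (t : T) => smul_add (F.E t) a b
      map_smul' s n := CoextendScalars.ext <| LinearMap.ext fun (t : T) =>
        ((congrArg (· • (n : N)) (F.map_right t s)).trans (mul_smul _ _ _)).symm }
  naturality M N g := by
    ext n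
    exact CoextendScalars.ext <| LinearMap.ext fun (t : T) => (map_smul g.hom (F.E t) n).symm

/-- The sum `∑ x i • φ (y i)` is linear in `φ`. -/
theorem sum_smul_apply {M : Type*} [AddCommGroup M] [Module T M] (φ : T →+ M)
    (hφ : ∀ s t, φ (f s * t) = f s • φ t) (t : T) :
    ∑ i, F.x i • φ (F.y i * t) = t • ∑ i, F.x i • φ (F.y i) := by
  -- Behind this is that `∑ x i ⊗ y i` commutes with `t`: expand `y i * t` in the `y j`, swap the
  -- sums, and recognise the expansion of `t * x j` in the `x i`.
  have h (i) : φ (F.y i * t) = ∑ j, f (F.E (F.y i * t * F.x j)) • φ (F.y j) := by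
    conv_lhs => rw [← F.sum_right (F.y i * t)]
    simp only [map_sum, hφ]
  simp only [h, Finset.smul_sum, ← mul_smul]
  rw [Finset.sum_comm]
  refine Finset.sum_congr rfl fun j _ => ?_
  rw [← Finset.sum_smul]
  congr 1
  simpa only [mul_assoc] using F.sum_left (t * F.x j)

/-- The counit of the adjunction between coextension and restriction of scalars. -/
def counit : restrictScalars f ⋙ coextendScalars.{u, u, u} f ⟶ 𝟭 (ModuleCat.{u} T) where
  app M := ofHom (X := (coextendScalars f).obj ((restrictScalars f).obj M)) (Y := M)
    { toFun φ := ∑ i, F.x i • (show M from φ (F.y i))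
      map_add' φ ψ := by
        rw [← Finset.sum_add_distrib]
        exact Finset.sum_congr rfl fun i _ => smul_add (F.x i) (φ (F.y i) : M) (ψ (F.y i) : M)
      map_smul' t φ := F.sum_smul_apply (M := M)
        (AddMonoidHom.mk' (fun t : T => (show M from φ t))
          (CoextendScalars.equiv f _ φ).map_add)
        (fun s (t : T) => (CoextendScalars.equiv f _ φ).map_smul s t) t }
  naturality M N g := by
    ext φ
    refine Eq.symm <| (map_sum g.hom _ _).trans ?_
    exact Finset.sum_congr rfl fun i _ => g.hom.map_smul (F.x i) (CoextendScalars.equiv f _ φ (F.y i))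

/-- For a Frobenius extension, coextension of scalars is left adjoint to restriction
of scalars. -/
def adjunction : coextendScalars.{u, u, u} f ⊣ restrictScalars.{u} f :=
  Adjunction.mkOfUnitCounit
    { unit := F.unit
      counit := F.counit
      left_triangle := by
        ext N φ
        refine CoextendScalars.ext <| LinearMap.ext fun (t : T) => ?_
        let ψ : T → N := CoextendScalars.equiv f N φ
        let ev : (coextendScalars.{u, u, u} f).obj N →+ N :=
          AddMonoidHom.mk' (fun χ => CoextendScalars.equiv f N χ t) fun _ _ => rfl
        -- The left triangle identity reduces to `sum_right`, the right one to `sum_left`.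
        have hψ : ∑ i, F.E (t * F.x i) • ψ (F.y i) = ψ t := by
          refine Eq.trans ?_ (congrArg ψ (F.sum_right t))
          refine Eq.symm <| (map_sum (CoextendScalars.equiv f N φ) _ _).trans ?_
          exact Finset.sum_congr rfl fun i _ =>
            (CoextendScalars.equiv f N φ).map_smul (F.E (t * F.x i)) (F.y i)
        exact (map_sum ev _ _).trans hψ
      right_triangle := by
        ext M (m : M)
        refine Eq.trans (b := ∑ i, (F.x i * f (F.E (F.y i * 1))) • m) ?_ ?_
        · refine Finset.sum_congr rfl fun i _ => ?_
          rw [mul_one]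
          exact (mul_smul (F.x i) (f (F.E (F.y i))) m).symm
        · rw [← Finset.sum_smul, F.sum_left]
          exact one_smul T m }

-- Restriction preserves injectives because its left adjoint, coextension, preserves monomorphisms.
include F in
theorem hasInjectiveDimensionLT_restrictScalars (n : ℕ) (M : ModuleCat.{u} T)
    [HasInjectiveDimensionLT M n] :
    HasInjectiveDimensionLT ((restrictScalars f).obj M) n := by
  have := F.adjunction.isRightAdjoint
  have := F.adjunction.isLeftAdjoint
  have := Functor.preservesInjectiveObjects_of_adjunction_of_preservesMonomorphisms F.adjunction
  exact (restrictScalars.{u} f).hasInjectiveDimensionLT_obj n M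

-- Coextension is exact, having adjoints on both sides, and preserves injectives because its left
-- adjoint, restriction, preserves monomorphisms.
include F in
theorem hasInjectiveDimensionLT_coextendScalars (n : ℕ) (N : ModuleCat.{u} S)
    [HasInjectiveDimensionLT N n] :
    HasInjectiveDimensionLT ((coextendScalars.{u, u, u} f).obj N) n := by
  have := F.adjunction.isRightAdjoint
  have := F.adjunction.isLeftAdjoint
  have := Functor.preservesInjectiveObjects_of_adjunction_of_preservesMonomorphisms
    (restrictCoextendScalarsAdj.{u, u, u} f)
  have : (coextendScalars.{u, u, u} f).Additive := ⟨rfl⟩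
  exact (coextendScalars.{u, u, u} f).hasInjectiveDimensionLT_obj n N


/-- For a Frobenius extension `T` of `S`, the coextension of `S` is `T`. -/
def coextendIso : (coextendScalars.{u, u, u} f).obj (of S S) ≅ of T T :=
  LinearEquiv.toModuleIso
    { toFun φ := ∑ i, F.x i * f (φ (F.y i))
      invFun t := (CoextendScalars.equiv f (of S S)).symm
        { toFun (a : T) := F.E (a * t)
          map_add' (a b : T) := (congrArg F.E (add_mul a b t)).trans (F.E.map_add _ _)
          map_smul' s (a : T) := (congrArg F.E (mul_assoc (f s) a t)).trans (F.map_left _ _) }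
      left_inv φ := by
        refine CoextendScalars.ext <| LinearMap.ext fun (t : T) => ?_
        let ψ : T → S := CoextendScalars.equiv f (of S S) φ
        change F.E (t * ∑ i, F.x i * f (ψ (F.y i))) = ψ t
        simp only [Finset.mul_sum, map_sum, ← mul_assoc]
        refine (Finset.sum_congr rfl fun i _ => F.map_right (t * F.x i) (ψ (F.y i))).trans ?_
        refine Eq.trans ?_ (congrArg ψ (F.sum_right t))
        refine Eq.symm <| (map_sum (CoextendScalars.equiv f (of S S) φ) _ _).trans ?_
        exact Finset.sum_congr rfl fun i _ =>
          (CoextendScalars.equiv f (of S S) φ).map_smul (F.E (t * F.x i)) (F.y i)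
      right_inv t := F.sum_left t
      map_add' φ ψ := by
        rw [← Finset.sum_add_distrib]
        refine Finset.sum_congr rfl fun i _ => ?_
        exact (congrArg (F.x i * ·) (f.map_add (φ (F.y i)) (ψ (F.y i)))).trans (mul_add _ _ _)
      map_smul' t φ := F.sum_smul_apply (M := T)
        (f.toAddMonoidHom.comp (AddMonoidHom.mk' (fun t : T => (show S from φ t))
          (CoextendScalars.equiv f _ φ).map_add))
        (fun s (t : T) => (congrArg f ((CoextendScalars.equiv f _ φ).map_smul s t)).trans (map_mul f _ _)) t }

/-- If the Frobenius homomorphism of a Frobenius extension `T` of `S` restricts to the identity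
of `S`, then `S` is a direct summand of `T` as a left module. -/
def retract (hE : ∀ s, F.E (f s) = s) : Retract (of S S) ((restrictScalars f).obj (of T T)) where
  i := ofHom (Y := (restrictScalars f).obj (of T T))
    { toFun s := f s
      map_add' := f.map_add
      map_smul' := f.map_mul }
  r := ofHom (X := (restrictScalars f).obj (of T T))
    { toFun (t : T) := F.E t
      map_add' (a b : T) := F.E.map_add a b
      map_smul' s (t : T) := F.map_left s t }
  retract := by
    ext
    exact hE 1

include F in
theorem hasInjectiveDimensionLT_self (n : ℕ) (h : HasInjectiveDimensionLT (of S S) n) :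
    HasInjectiveDimensionLT (of T T) n :=
  have := F.hasInjectiveDimensionLT_coextendScalars n (of S S)
  hasInjectiveDimensionLT_of_iso F.coextendIso n

theorem hasInjectiveDimensionLT_of_retraction (hE : ∀ s, F.E (f s) = s) (n : ℕ)
    (h : HasInjectiveDimensionLT (of T T) n) : HasInjectiveDimensionLT (of S S) n :=
  have := F.hasInjectiveDimensionLT_restrictScalars n (of T T)
  (F.retract hE).hasInjectiveDimensionLT n

end ModuleCat

end FrobeniusSystem

/-! ### Gorenstein rings -/

section Gorenstein

open CategoryTheory ModuleCat

/-- The ring `Aᵐᵒᵖ` is isomorphic to `A` as a right `A`-module. -/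
def opSelfLinearEquiv (A : Type*) [Ring A] : A ≃ₗ[Aᵐᵒᵖ] Aᵐᵒᵖ where
  __ := MulOpposite.opAddEquiv
  map_smul' _ _ := rfl

/-- Right conditions on `A` become left conditions on `Aᵐᵒᵖ`, so left-handed results for `F` and
`F.op` suffice. -/
theorem isNGorenstein_iff {n : ℕ} {A : Type u} [Ring A] :
    IsNGorenstein n A ↔
      (IsNoetherian A A ∧ HasInjectiveDimensionLE (of A A) n) ∧
      IsNoetherian Aᵐᵒᵖ Aᵐᵒᵖ ∧ HasInjectiveDimensionLE (of Aᵐᵒᵖ Aᵐᵒᵖ) n := by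
  have h₁ : IsNoetherian Aᵐᵒᵖ A ↔ IsNoetherian Aᵐᵒᵖ Aᵐᵒᵖ :=
    (opSelfLinearEquiv A).isNoetherian_iff
  have h₂ : HasInjectiveDimensionLE (of Aᵐᵒᵖ A) n ↔ HasInjectiveDimensionLE (of Aᵐᵒᵖ Aᵐᵒᵖ) n :=
    ⟨fun _ => hasInjectiveDimensionLT_of_iso (opSelfLinearEquiv A).toModuleIso _,
      fun _ => hasInjectiveDimensionLT_of_iso (opSelfLinearEquiv A).symm.toModuleIso _⟩
  rw [← h₁, ← h₂]
  exact ⟨fun h => ⟨⟨h.1, h.3⟩, h.2, h.4⟩, fun h => ⟨h.1.1, h.2.1, h.1.2, h.2.2⟩⟩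

variable {S T : Type u} [Ring S] [Ring T] {f : S →+* T} (F : FrobeniusSystem f) {n : ℕ}

include F in
/-- A Frobenius extension of an `n`-Gorenstein ring is `n`-Gorenstein. -/
theorem FrobeniusSystem.isNGorenstein (h : IsNGorenstein n S) : IsNGorenstein n T := by
  rw [isNGorenstein_iff] at h ⊢
  exact ⟨⟨F.isNoetherian h.1.1, F.hasInjectiveDimensionLT_self _ h.1.2⟩,
    F.op.isNoetherian h.2.1, F.op.hasInjectiveDimensionLT_self _ h.2.2⟩

/-- If the Frobenius homomorphism of a Frobenius extension `T` of `S` restricts to the identity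
of `S` and `T` is `n`-Gorenstein, then so is `S`. -/
theorem FrobeniusSystem.isNGorenstein_of_retraction (hE : ∀ s, F.E (f s) = s)
    (h : IsNGorenstein n T) : IsNGorenstein n S := by
  have hE' (s : Sᵐᵒᵖ) : F.op.E (f.op s) = s := congrArg MulOpposite.op (hE s.unop)
  rw [isNGorenstein_iff] at h ⊢
  exact ⟨⟨F.isNoetherian_of_retraction hE h.1.1, F.hasInjectiveDimensionLT_of_retraction hE _ h.1.2⟩,
    F.op.isNoetherian_of_retraction hE' h.2.1,
    F.op.hasInjectiveDimensionLT_of_retraction hE' _ h.2.2⟩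

end Gorenstein

/-! ### Skew group rings over subgroups -/

section SkewGroupRing

open SkewMonoidAlgebra

variable (R : Type*) {G : Type*} [Ring R] [Group G] (H : Subgroup G)

/-- The projection `∑ r_g g ↦ ∑ r_h h` of `RG` onto `RH`, where `h` runs through `H`. -/
def skewProjection : SkewMonoidAlgebra R G →+ SkewMonoidAlgebra R H :=
  AddMonoidHom.mk' (fun t => ⟨t.coeff.comapDomain H.subtype H.subtype_injective.injOn⟩)
    fun a b => by ext; simp

theorem skewProjection_single_coe (h : H) (r : R) :
    skewProjection R H (single (h : G) r) = single h r :=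
  congrArg SkewMonoidAlgebra.ofCoeff <| Finsupp.comapDomain_single H.subtype h r _

theorem skewProjection_single_of_mem {g : G} (hg : g ∈ H) (r : R) :
    skewProjection R H (single g r) = single ⟨g, hg⟩ r :=
  skewProjection_single_coe R H ⟨g, hg⟩ r

theorem skewProjection_single_of_notMem {g : G} (hg : g ∉ H) (r : R) :
    skewProjection R H (single g r) = 0 := by
  ext h
  exact Finsupp.single_eq_of_ne fun h' => hg (h' ▸ h.2)

variable [MulSemiringAction G R]

theorem skewProjection_inclusion (s : SkewMonoidAlgebra R H) :
    skewProjection R H (skewInclusion R H s) = s := by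
  induction s with
  | single h r => rw [skewInclusion_single, skewProjection_single_coe]
  | add a b ha hb => rw [map_add, map_add, ha, hb]

/-- For `h ∈ H`, the products `h * g` and `g * h` lie in `H` exactly when `g` does; this makes the
projection a bimodule map. -/
theorem skewProjection_inclusion_mul (s : SkewMonoidAlgebra R H) (t : SkewMonoidAlgebra R G) :
    skewProjection R H (skewInclusion R H s * t) = s * skewProjection R H t := by
  induction t with
  | single g r =>
    induction s with
    | single h r' =>
      rw [skewInclusion_single, single_mul_single]
      by_cases hg : g ∈ H
      · rw [skewProjection_single_of_mem R H hg,
          skewProjection_single_of_mem R H (H.mul_mem h.2 hg), single_mul_single]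
        rfl
      · rw [skewProjection_single_of_notMem R H hg,
          skewProjection_single_of_notMem R H (mt (H.mul_mem_cancel_left h.2).1 hg), mul_zero]
    | add a b ha hb => rw [map_add, add_mul, map_add, ha, hb, add_mul]
  | add a b ha hb => rw [mul_add, map_add, ha, hb, map_add, mul_add]

theorem skewProjection_mul_inclusion (t : SkewMonoidAlgebra R G) (s : SkewMonoidAlgebra R H) :
    skewProjection R H (t * skewInclusion R H s) = skewProjection R H t * s := by
  induction t with
  | single g r =>
    induction s with
    | single h r' =>
      rw [skewInclusion_single, single_mul_single]
      by_cases hg : g ∈ H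
      · rw [skewProjection_single_of_mem R H hg,
          skewProjection_single_of_mem R H (H.mul_mem hg h.2), single_mul_single]
        rfl
      · rw [skewProjection_single_of_notMem R H hg,
          skewProjection_single_of_notMem R H (mt (H.mul_mem_cancel_right h.2).1 hg), zero_mul]
    | add a b ha hb => rw [map_add, mul_add, map_add, ha, hb, mul_add]
  | add a b ha hb => rw [add_mul, map_add, ha, hb, map_add, add_mul]

theorem sum_single_mul_skewProjection [Fintype (G ⧸ H)] (t : SkewMonoidAlgebra R G) :
    ∑ q : G ⧸ H, single q.out 1 *
      skewInclusion R H (skewProjection R H (single q.out⁻¹ 1 * t)) = t := by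
  induction t with
  | single g r =>
    -- `q.out⁻¹ * g ∈ H` only for the coset `q = gH`; there the actions of `q.out⁻¹` and `q.out` on
    -- `r` cancel.
    rw [Finset.sum_eq_single (g : G ⧸ H)]
    · have hg : (g : G ⧸ H).out⁻¹ * g ∈ H := QuotientGroup.eq.1 (Quotient.out_eq' _)
      rw [single_mul_single, skewProjection_single_of_mem R H hg, skewInclusion_single,
        single_mul_single]
      simp
    · intro q _ hq
      have hg : q.out⁻¹ * g ∉ H := fun h =>
        hq ((QuotientGroup.out_eq' q).symm.trans (QuotientGroup.eq.2 h))
      rw [single_mul_single, skewProjection_single_of_notMem R H hg, map_zero, mul_zero]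
    · simp
  | add a b ha hb =>
    simp only [mul_add, map_add, Finset.sum_add_distrib, ha, hb]

theorem sum_skewProjection_mul_single [Fintype (G ⧸ H)] (t : SkewMonoidAlgebra R G) :
    ∑ q : G ⧸ H, skewInclusion R H (skewProjection R H (t * single q.out 1)) *
      single q.out⁻¹ 1 = t := by
  induction t with
  | single g r =>
    -- The coset is now that of `g⁻¹`, since `g * q.out ∈ H` means `q.out ∈ g⁻¹H`: inverses of left
    -- coset representatives represent the right cosets.
    rw [Finset.sum_eq_single ((g⁻¹ : G) : G ⧸ H)]
    · have hg : g * ((g⁻¹ : G) : G ⧸ H).out ∈ H := by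
        simpa using QuotientGroup.eq.1 (Quotient.out_eq' ((g⁻¹ : G) : G ⧸ H)).symm
      rw [single_mul_single, skewProjection_single_of_mem R H hg, skewInclusion_single,
        single_mul_single]
      simp
    · intro q _ hq
      have hg : g * q.out ∉ H := fun h =>
        hq ((QuotientGroup.out_eq' q).symm.trans (QuotientGroup.eq.2 (by simpa using h)).symm)
      rw [single_mul_single, skewProjection_single_of_notMem R H hg, map_zero, zero_mul]
    · simp
  | add a b ha hb =>
    simp only [add_mul, map_add, Finset.sum_add_distrib, ha, hb]

/-- The skew group ring of a finite group is a Frobenius extension of the skew group ring of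
a subgroup, with coset representatives and their inverses as dual bases. -/
def skewFrobeniusSystem [Finite G] : FrobeniusSystem (skewInclusion R H) :=
  letI := Fintype.ofFinite (G ⧸ H)
  { E := skewProjection R H
    map_left := skewProjection_inclusion_mul R H
    map_right := skewProjection_mul_inclusion R H
    ι := G ⧸ H
    x q := single q.out 1
    y q := single q.out⁻¹ 1
    sum_left := sum_single_mul_skewProjection R H
    sum_right := sum_skewProjection_mul_single R H }

end SkewGroupRing

end

/-- The separability hypothesis of the second part is not needed: every skew group ring of a
finite group is a Frobenius extension of the skew group ring of a subgroup. -/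
theorem corollary7p4 {R : Type*} {G : Type*} [Ring R] [Group G] [Finite G]
    [MulSemiringAction G R] (H : Subgroup G) (n : ℕ) :
    (IsNGorenstein n (SkewMonoidAlgebra R G) → IsNGorenstein n (SkewMonoidAlgebra R H)) ∧
    (IsSeparableExtension (skewInclusion R H) →
      (IsNGorenstein n (SkewMonoidAlgebra R G) ↔ IsNGorenstein n (SkewMonoidAlgebra R H))) := by
  have h : IsNGorenstein n (SkewMonoidAlgebra R G) → IsNGorenstein n (SkewMonoidAlgebra R H) :=
    (skewFrobeniusSystem R H).isNGorenstein_of_retraction (skewProjection_inclusion R H)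
  exact ⟨h, fun _ => ⟨h, (skewFrobeniusSystem R H).isNGorenstein⟩⟩
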